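/- Let $(\Omega,\mu)$ be a space of total measure one (for instance a subset of $\mathbb R^n$ of Lebesgue measure $1$). For measurable $f:\Omega\to\mathbb R$ let $f_*(s)=\inf\{t\ge 0:\mu\{|f|>t\}\le s\}$, $0<s<1$, be its decreasing rearrangement. For $1<p<\infty$ let $L^{p,\infty}$ and the small Lebesgue space $L^{(p}$ be given by $$\|f\|_{L^{p,\infty}}=\sup_{0<s<1}s^{1/p}f_*(s),\qquad \|f\|_{L^{(p}}=\int_0^1(1-\log t)^{-1/p}\Big(\int_0^t f_*^p(\sigma)\,d\sigma\Big)^{1/p}\frac{dt}{t}.$$ For $t>0$ let $K(f,t)=\inf\{\|g\|_{L^{p,\infty}}+t\|h\|_{L^{(p}}: f=g+h \text{ a.e.},\ g,h\text{ measurable}\}\in[0,\infty]$ (so $K(f,t)=\infty$ if $f\notin L^{p,\infty}+L^{(p}$), and for $0<\theta<1$, $1\le q<\infty$ put $$\|f\|_{(L^{p,\infty},L^{(p})_{\theta,q}}=\big\|t^{-\theta-1/q}K(f,t)\big\|_{L^q(0,1)}.$$ For $1\le r<\infty$ and weights on $(0,1)$ put $$\|f\|_{G\Gamma(p,r;w_1,w_2)}=\Big[\int_0^1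 w_1(t)\Big(\int_0^t f_*^p(\sigma)w_2(\sigma)\,d\sigma\Big)^{r/p}dt\Big]^{1/r},\qquad \|f\|_{G\Gamma(\infty,r;v_1,v_2)}=\Big[\int_0^1 v_1(t)\Big(\sup_{0<s<t}v_2(s)f_*(s)\Big)^{r}dt\Big]^{1/r},$$ and let the norm of the intersection of two spaces be the maximum of the two norms. **Theorem.** Let $1<p<\infty$, $0<\theta<1$, $1\le r<\infty$, and $$w_1(t)=t^{-1}(1-\log t)^{r\theta-1},\quad w_2(t)=(1-\log t)^{-1},\quad v_1(t)=t^{-1}(1-\log t)^{r\theta(1-1/p)-1},\quad v_2(t)=t^{1/p}.$$ There is a constant $C>0$, depending only on $p,\theta,r$, such that for every such $(\Omega,\mu)$, every measurable $f:\Omega\to\mathbb R$, and both $q=1$ and $q=r$, $$\|f\|_{G\Gamma(p,r;w_1,w_2)\cap G\Gamma(\infty,r;v_1,v_2)}\le C\,\|f\|_{(L^{p,\infty},L^{(p})_{\theta,q}},$$ where all norms take values in $[0,\infty]$; in particular every $f$ for which the right-hand side is finite belongs to the intersection. -/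

import Mathlib

open MeasureTheory Set
open scoped ENNReal

noncomputable section

namespace GGamma

variable {Ω : Type*} [MeasurableSpace Ω]

/-- The decreasing rearrangement `f_*(s) = inf {t : μ {|f| > t} ≤ s}` of `f`. -/
def rearr (μ : Measure Ω) (f : Ω → ℝ) (s : ℝ) : ℝ≥0∞ :=
  sInf {t : ℝ≥0∞ | μ {x | t < ‖f x‖ₑ} ≤ ENNReal.ofReal s}

/-- The quasi-norm `sup_{0<s<1} s^{1/p} f_*(s)` of the Lorentz–Marcinkiewicz space `L^{p,∞}`
over a space of measure one. -/
def weakNorm (μ : Measure Ω) (p : ℝ) (f : Ω → ℝ) : ℝ≥0∞ :=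
  ⨆ s ∈ Ioo (0 : ℝ) 1, ENNReal.ofReal (s ^ (1 / p)) * rearr μ f s

/-- The norm `∫₀¹ (1 - log t)^{-α/p+α-1} (∫₀ᵗ f_*(σ)^p dσ)^{1/p} dt/t` of the small Lebesgue
space `L^{(p,α}`; the space `L^{(p}` is the case `α = 1`. -/
def smallNorm (μ : Measure Ω) (p α : ℝ) (f : Ω → ℝ) : ℝ≥0∞ :=
  ∫⁻ t in Ioo (0 : ℝ) 1, ENNReal.ofReal ((1 - Real.log t) ^ (-α / p + α - 1) / t) *
    (∫⁻ σ in Ioo 0 t, rearr μ f σ ^ p) ^ (1 / p)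

/-- Peetre's `K`-functional of the couple of function spaces with the `[0,∞]`-valued norms
`N₀` and `N₁`. It is `∞` when `f` is not in the sum of the two spaces. -/
def peetreK (μ : Measure Ω) (N₀ N₁ : (Ω → ℝ) → ℝ≥0∞) (f : Ω → ℝ) (t : ℝ) : ℝ≥0∞ :=
  ⨅ (g : Ω → ℝ) (h : Ω → ℝ) (_ : Measurable g) (_ : Measurable h) (_ : f =ᵐ[μ] g + h),
    N₀ g + ENNReal.ofReal t * N₁ h

/-- The norm `‖t^{-θ-1/q} K(f,t)‖_{L^q(0,1)}`, `1 ≤ q < ∞`, of the real interpolation space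
`(X₀, X₁)_{θ,q}`. -/
def interpNorm (μ : Measure Ω) (N₀ N₁ : (Ω → ℝ) → ℝ≥0∞) (θ q : ℝ) (f : Ω → ℝ) : ℝ≥0∞ :=
  (∫⁻ t in Ioo (0 : ℝ) 1,
    (ENNReal.ofReal (t ^ (-θ - 1 / q)) * peetreK μ N₀ N₁ f t) ^ q) ^ (1 / q)

/-- The quasi-norm `[∫₀¹ w₁(t) (∫₀ᵗ f_*(σ)^p w₂(σ) dσ)^{m/p} dt]^{1/m}` of the Lorentz
`GΓ(p,m;w₁,w₂)` space, for finite `p` and `m`. -/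
def gGammaNorm (μ : Measure Ω) (p m : ℝ) (w₁ w₂ : ℝ → ℝ) (f : Ω → ℝ) : ℝ≥0∞ :=
  (∫⁻ t in Ioo (0 : ℝ) 1, ENNReal.ofReal (w₁ t) *
    (∫⁻ σ in Ioo 0 t, rearr μ f σ ^ p * ENNReal.ofReal (w₂ σ)) ^ (m / p)) ^ (1 / m)

/-- The quasi-norm `[∫₀¹ v₁(t) (sup_{0<s<t} v₂(s) f_*(s))^m dt]^{1/m}` of the Lorentz
`GΓ(∞,m;v₁,v₂)` space, for finite `m`. -/
def gGammaSupNorm (μ : Measure Ω) (m : ℝ) (v₁ v₂ : ℝ → ℝ) (f : Ω → ℝ) : ℝ≥0∞ :=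
  (∫⁻ t in Ioo (0 : ℝ) 1, ENNReal.ofReal (v₁ t) *
    (⨆ s ∈ Ioo (0 : ℝ) t, ENNReal.ofReal (v₂ s) * rearr μ f s) ^ m) ^ (1 / m)

end GGamma

end

/-!
Write `l(t) = 1 - log t` and let `K` be Peetre's functional of the couple `(L^{p,∞}, L^{(p})`. The
intersection norm is controlled by two pointwise lower bounds for `K`, each at a single parameter.

* `sup_{s<t} s^{1/p} f_*(s) ≤ 8 K(f, l(t)^{-(1-1/p)})` (`GGamma.iSup_rearr_le_peetreK`).
* `(∫ f_*^p / l)^{1/p} ≤ 8 K(f, 1/l(t))`, the integral being over a block below `t` on which `l` at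
  most doubles (`GGamma.lintegral_block_le_peetreK`). The block is essential: the integral over
  `(0,t)` may diverge for functions in `L^{p,∞}`.

Both come from `f_*(s) ≤ g_*(s/2) + h_*(s/2)` for `f = g + h`. The `g` part is controlled by
`g_*(s) ≤ s^{-1/p} ‖g‖_{p,∞}`, the `h` part by
`l(t)^{1-1/p} (∫₀^{t/2} h_*^p)^{1/p} ≤ 4 ‖h‖_{(p}` (`GGamma.mul_rpow_le_smallNorm`).

The substitutions `τ = l(t)^{-(1-1/p)}` and `τ = 2^{-j} / l(t)` (`GGamma.lintegral_comp_log_le`) turn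
the weighted integrals of `K` over `t` into the `r`-th power of the interpolation norm. The first
bound gives the `GΓ(∞,r)` norm directly. For the `GΓ(p,r)` norm, `(0,t)` is covered by the blocks
where `l` runs from `2^j l(t)` to `2^{j+1} l(t)`; the `j`-th one contributes a factor `2^{-jrθ}`,
which makes the sum over `j` converge for `θ > 0`.

Finally `(X₀, X₁)_{θ,1}` embeds into `(X₀, X₁)_{θ,r}` by the doubling property of `K`
(`GGamma.interpNorm_le_interpNorm_one`), which reduces `q = 1` to `q = r`.
-/

namespace GGamma

variable {Ω : Type*} [MeasurableSpace Ω]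

/-! ### Decreasing rearrangement and Peetre's functional -/

lemma rearr_antitone (μ : Measure Ω) (f : Ω → ℝ) : Antitone (rearr μ f) := fun _ _ hst =>
  sInf_le_sInf fun _ ht => le_trans ht (ENNReal.ofReal_le_ofReal hst)

lemma measurable_rearr (μ : Measure Ω) (f : Ω → ℝ) : Measurable (rearr μ f) :=
  (rearr_antitone μ f).measurable

lemma rearr_le_add {μ : Measure Ω} {f g h : Ω → ℝ} (hf : f =ᵐ[μ] g + h) {s : ℝ} (hs : 0 ≤ s) :
    rearr μ f s ≤ rearr μ g (s / 2) + rearr μ h (s / 2) := by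
  unfold rearr
  rw [sInf_eq_iInf (s := {t : ℝ≥0∞ | μ {x | t < ‖g x‖ₑ} ≤ _}),
    sInf_eq_iInf (s := {t : ℝ≥0∞ | μ {x | t < ‖h x‖ₑ} ≤ _})]
  refine ENNReal.le_iInf₂_add_iInf₂ fun a ha b hb => sInf_le ?_
  have hsub : {x | a + b < ‖f x‖ₑ} ≤ᵐ[μ] ({x | a < ‖g x‖ₑ} ∪ {x | b < ‖h x‖ₑ} : Set Ω) := by
    filter_upwards [hf] with x hx
    intro hlt
    change a + b < ‖f x‖ₑ at hlt
    change a < ‖g x‖ₑ ∨ b < ‖h x‖ₑ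
    by_contra! hcon
    rw [hx] at hlt
    exact absurd (hlt.trans_le ((enorm_add_le _ _).trans (add_le_add hcon.1 hcon.2)))
      (lt_irrefl _)
  calc μ {x | a + b < ‖f x‖ₑ} ≤ μ ({x | a < ‖g x‖ₑ} ∪ {x | b < ‖h x‖ₑ}) := measure_mono_ae hsub
    _ ≤ ENNReal.ofReal (s / 2) + ENNReal.ofReal (s / 2) :=
      (measure_union_le _ _).trans (add_le_add ha hb)
    _ = ENNReal.ofReal s := by
      rw [← ENNReal.ofReal_add (by positivity) (by positivity), add_halves]

lemma le_mul_peetreK {μ : Measure Ω} {N₀ N₁ : (Ω → ℝ) → ℝ≥0∞} {f : Ω → ℝ} {t : ℝ}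
    {A c : ℝ≥0∞} (hc : c ≠ 0) (hc' : c ≠ ∞)
    (H : ∀ g h : Ω → ℝ, Measurable g → Measurable h → f =ᵐ[μ] g + h →
      A ≤ c * (N₀ g + ENNReal.ofReal t * N₁ h)) :
    A ≤ c * peetreK μ N₀ N₁ f t := by
  rw [mul_comm, ← ENNReal.div_le_iff hc hc']
  refine le_iInf fun g => le_iInf fun h => le_iInf fun hg => le_iInf fun hh => le_iInf fun hf => ?_
  rw [ENNReal.div_le_iff hc hc', mul_comm]
  exact H g h hg hh hf

lemma peetreK_mono (μ : Measure Ω) (N₀ N₁ : (Ω → ℝ) → ℝ≥0∞) (f : Ω → ℝ) :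
    Monotone (peetreK μ N₀ N₁ f) := by
  intro s t hst
  unfold peetreK
  gcongr

lemma measurable_peetreK (μ : Measure Ω) (N₀ N₁ : (Ω → ℝ) → ℝ≥0∞) (f : Ω → ℝ) :
    Measurable (peetreK μ N₀ N₁ f) :=
  (peetreK_mono μ N₀ N₁ f).measurable

/-- The doubling property of `K`, a consequence of `t ↦ K(f,t)/t` being decreasing. -/
lemma peetreK_le_two_mul (μ : Measure Ω) (N₀ N₁ : (Ω → ℝ) → ℝ≥0∞) (f : Ω → ℝ) {s t : ℝ}
    (hst : t ≤ 2 * s) : peetreK μ N₀ N₁ f t ≤ 2 * peetreK μ N₀ N₁ f s := by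
  refine le_mul_peetreK two_ne_zero ENNReal.ofNat_ne_top fun g h hg hh hf => ?_
  have h1 : ENNReal.ofReal t ≤ 2 * ENNReal.ofReal s := by
    refine (ENNReal.ofReal_le_ofReal hst).trans ?_
    rw [ENNReal.ofReal_mul two_pos.le, ENNReal.ofReal_ofNat]
  calc peetreK μ N₀ N₁ f t ≤ N₀ g + ENNReal.ofReal t * N₁ h :=
        (iInf₂_le g h).trans ((iInf₂_le hg hh).trans (iInf_le _ hf))
    _ ≤ 2 * N₀ g + 2 * ENNReal.ofReal s * N₁ h := by
        gcongr
        exact le_mul_of_one_le_left (zero_le) one_le_two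
    _ = 2 * (N₀ g + ENNReal.ofReal s * N₁ h) := by ring

/-! ### Lower bounds for the small Lebesgue norm -/

lemma lintegral_ofReal_inv {a b : ℝ} (ha : 0 < a) (hab : a ≤ b) :
    ∫⁻ s in Ioc a b, ENNReal.ofReal s⁻¹ = ENNReal.ofReal (Real.log (b / a)) := by
  rw [← integral_inv_of_pos ha (ha.trans_le hab), intervalIntegral.integral_of_le hab]
  refine (ofReal_integral_eq_lintegral_ofReal ?_ ?_).symm
  · refine (intervalIntegrable_iff_integrableOn_Ioc_of_le hab).1 ?_
    refine intervalIntegral.intervalIntegrable_inv (fun x hx => ?_) continuousOn_id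
    rw [uIcc_of_le hab] at hx
    exact (ha.trans_le hx.1).ne'
  · filter_upwards [ae_restrict_mem measurableSet_Ioc] with x hx
    exact inv_nonneg.2 (ha.trans hx.1).le

lemma lintegral_comp_half (F : ℝ → ℝ≥0∞) (t : ℝ) :
    ∫⁻ s in Ioo 0 t, F (s / 2) = 2 * ∫⁻ s in Ioo 0 (t / 2), F s := by
  have h := lintegral_image_eq_lintegral_abs_deriv_mul (s := Ioo 0 (t / 2)) (f := fun x => 2 * x)
    (f' := fun _ => 2) measurableSet_Ioo
    (fun x _ => by simpa using ((hasDerivAt_id x).const_mul 2).hasDerivWithinAt)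
    (fun x _ y _ hxy => by simpa using hxy) (fun s => F (s / 2))
  have him : (fun x : ℝ => 2 * x) '' Ioo 0 (t / 2) = Ioo 0 t := by
    rw [image_mul_left_Ioo two_pos]
    congr 1 <;> ring
  rw [him] at h
  rw [h, ← lintegral_const_mul' _ _ ENNReal.ofNat_ne_top]
  simp

lemma one_le_one_sub_log {t : ℝ} (h0 : 0 < t) (h1 : t ≤ 1) : 1 ≤ 1 - Real.log t := by
  linarith [Real.log_nonpos h0.le h1]

/-- The integral defining the norm of `L^{(p}` is at least its part over `(t/2,1)`, on which the
inner integral is at least `∫₀^{t/2} h_*^p`. Cutting at `t/2` instead of `t` keeps the constant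
uniform as `t → 1`. -/
lemma mul_rpow_le_smallNorm (μ : Measure Ω) {p : ℝ} (hp : 1 < p) (h : Ω → ℝ) {t : ℝ}
    (ht : t ∈ Ioo (0 : ℝ) 1) :
    ENNReal.ofReal ((1 - Real.log t) ^ (1 - 1 / p)) *
      (∫⁻ σ in Ioo 0 (t / 2), rearr μ h σ ^ p) ^ (1 / p) ≤ 4 * smallNorm μ p 1 h := by
  obtain ⟨ht0, ht1⟩ := ht
  have hp0 : 0 < p := one_pos.trans hp
  set l := 1 - Real.log t with hl
  have hl1 : 1 ≤ l := one_le_one_sub_log ht0 ht1.le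
  set I := (∫⁻ σ in Ioo 0 (t / 2), rearr μ h σ ^ p) ^ (1 / p) with hI
  have hlog2 : Real.log 2 ≤ 1 := by linarith [Real.log_two_lt_d9]
  have hlog2' : 1 / 2 ≤ Real.log 2 := by linarith [Real.log_two_gt_d9]
  have key : ENNReal.ofReal ((2 * l) ^ (-1 / p)) * I * ENNReal.ofReal (Real.log (1 / (t / 2)))
      ≤ smallNorm μ p 1 h := by
    rw [← lintegral_ofReal_inv (by positivity) (by linarith),
      ← lintegral_const_mul _ (by fun_prop), setLIntegral_congr Ioo_ae_eq_Ioc.symm]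
    unfold smallNorm
    refine (setLIntegral_mono' measurableSet_Ioo fun s hs => ?_).trans
      (lintegral_mono_set (Ioo_subset_Ioo_left (by positivity : (0 : ℝ) ≤ t / 2)))
    have hs0 : 0 < s := lt_trans (by positivity) hs.1
    have hls : 1 ≤ 1 - Real.log s := one_le_one_sub_log hs0 hs.2.le
    have hls2 : 1 - Real.log s ≤ 2 * l := by
      have := Real.log_le_log (by positivity) hs.1.le
      rw [Real.log_div ht0.ne' two_ne_zero] at this
      linarith
    rw [mul_right_comm, ← ENNReal.ofReal_mul (by positivity), ← div_eq_mul_inv]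
    gcongr ENNReal.ofReal (?_ / s) * ?_
    · rw [show (-1 / p + 1 - 1 : ℝ) = -1 / p by ring]
      exact Real.rpow_le_rpow_of_nonpos (by positivity) hls2
        (div_nonpos_of_nonpos_of_nonneg (by norm_num) hp0.le)
    · exact ENNReal.rpow_le_rpow (lintegral_mono_set (Ioo_subset_Ioo_right hs.1.le))
        (by positivity)
  refine le_trans ?_ (mul_le_mul_right key 4)
  have hreal : l ^ (1 - 1 / p) ≤ 4 * ((2 * l) ^ (-1 / p) * Real.log (1 / (t / 2))) := by
    have e1 : Real.log (1 / (t / 2)) = Real.log 2 + l - 1 := by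
      rw [one_div_div, Real.log_div two_ne_zero ht0.ne']; ring
    have e2 : l / 2 ≤ Real.log (1 / (t / 2)) := by rw [e1]; linarith
    have e3 : (1 / 2 : ℝ) ≤ 2 ^ (-1 / p) := by
      rw [show (1 / 2 : ℝ) = 2 ^ (-1 : ℝ) by norm_num [Real.rpow_neg_one]]
      refine Real.rpow_le_rpow_of_exponent_le one_le_two ?_
      rw [le_div_iff₀ hp0]; linarith
    have e4 : l ^ (1 - 1 / p) = l ^ (-1 / p) * l := by
      rw [← Real.rpow_add_one (by positivity)]; congr 1; ring
    rw [e4, Real.mul_rpow two_pos.le (by positivity)]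
    calc l ^ (-1 / p) * l = 4 * (1 / 2 * l ^ (-1 / p) * (l / 2)) := by ring
      _ ≤ _ := by gcongr
  calc ENNReal.ofReal (l ^ (1 - 1 / p)) * I
      ≤ ENNReal.ofReal (4 * ((2 * l) ^ (-1 / p) * Real.log (1 / (t / 2)))) * I := by gcongr
    _ = _ := by
      rw [ENNReal.ofReal_mul (by norm_num), ENNReal.ofReal_mul (by positivity),
        ENNReal.ofReal_ofNat]
      ring

lemma ofReal_rpow_le_two_mul_half {p s : ℝ} (hp : 1 < p) (hs : 0 ≤ s) :
    ENNReal.ofReal (s ^ (1 / p)) ≤ 2 * ENNReal.ofReal ((s / 2) ^ (1 / p)) := by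
  rw [← ENNReal.ofReal_ofNat, ← ENNReal.ofReal_mul two_pos.le]
  refine ENNReal.ofReal_le_ofReal ?_
  have h2 : (2 : ℝ) ^ (1 / p) ≤ 2 := by
    conv_rhs => rw [← Real.rpow_one 2]
    exact Real.rpow_le_rpow_of_exponent_le one_le_two
      ((div_le_one (one_pos.trans hp)).2 hp.le)
  calc s ^ (1 / p) = (2 * (s / 2)) ^ (1 / p) := by ring_nf
    _ = 2 ^ (1 / p) * (s / 2) ^ (1 / p) := Real.mul_rpow two_pos.le (by positivity)
    _ ≤ 2 * (s / 2) ^ (1 / p) := by gcongr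

/-- The weak norm controls `s^{1/p} g_*(s/2)`. -/
lemma ofReal_mul_rearr_half_le_weakNorm (μ : Measure Ω) {p : ℝ} (hp : 1 < p) (g : Ω → ℝ) {s : ℝ}
    (hs : s ∈ Ioo (0 : ℝ) 1) :
    ENNReal.ofReal (s ^ (1 / p)) * rearr μ g (s / 2) ≤ 2 * weakNorm μ p g := by
  obtain ⟨hs0, hs1⟩ := hs
  have h1 : ENNReal.ofReal ((s / 2) ^ (1 / p)) * rearr μ g (s / 2) ≤ weakNorm μ p g :=
    le_iSup₂_of_le (f := fun s (_ : s ∈ Ioo (0 : ℝ) 1) =>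
      ENNReal.ofReal (s ^ (1 / p)) * rearr μ g s) (s / 2) ⟨by positivity, by linarith⟩ le_rfl
  refine le_trans ?_ (mul_le_mul_right h1 2)
  rw [← mul_assoc]
  gcongr
  exact ofReal_rpow_le_two_mul_half hp hs0.le

/-- Both norms of the couple bound `s^{1/p} f_*(s)` on `(0,t)`: `L^{p,∞}` with a constant and
`L^{(p}` with a constant times `(1 - log t)^{1/p-1}`. -/
lemma iSup_rearr_le_peetreK (μ : Measure Ω) {p : ℝ} (hp : 1 < p) (f : Ω → ℝ) {t : ℝ}
    (ht : t ∈ Ioo (0 : ℝ) 1) :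
    ⨆ s ∈ Ioo (0 : ℝ) t, ENNReal.ofReal (s ^ (1 / p)) * rearr μ f s ≤
      8 * peetreK μ (weakNorm μ p) (smallNorm μ p 1) f ((1 - Real.log t) ^ (-(1 - 1 / p))) := by
  refine le_mul_peetreK (by norm_num) ENNReal.ofNat_ne_top fun g h _ _ hf => ?_
  refine iSup₂_le fun s hs => ?_
  have hs' : s ∈ Ioo (0 : ℝ) 1 := ⟨hs.1, hs.2.trans ht.2⟩
  have hp0 : 0 < p := one_pos.trans hp
  have hl1 : 1 ≤ 1 - Real.log t := one_le_one_sub_log ht.1 ht.2.le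
  have hh : ENNReal.ofReal ((s / 2) ^ (1 / p)) * rearr μ h (s / 2) ≤
      (∫⁻ σ in Ioo 0 (t / 2), rearr μ h σ ^ p) ^ (1 / p) := by
    rw [one_div, ENNReal.le_rpow_inv_iff hp0, ENNReal.mul_rpow_of_nonneg _ _ hp0.le,
      ENNReal.ofReal_rpow_of_nonneg (Real.rpow_nonneg (by linarith [hs.1]) _) hp0.le,
      Real.rpow_inv_rpow (by linarith [hs.1]) hp0.ne']
    calc ENNReal.ofReal (s / 2) * rearr μ h (s / 2) ^ p
        = ∫⁻ _ in Ioo 0 (s / 2), rearr μ h (s / 2) ^ p := by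
          rw [setLIntegral_const, Real.volume_Ioo, sub_zero, mul_comm]
      _ ≤ ∫⁻ σ in Ioo 0 (s / 2), rearr μ h σ ^ p :=
          setLIntegral_mono' measurableSet_Ioo fun σ hσ =>
            ENNReal.rpow_le_rpow (rearr_antitone μ h hσ.2.le) hp0.le
      _ ≤ _ := lintegral_mono_set (Ioo_subset_Ioo_right (by linarith [hs.2]))
  have hsm := mul_rpow_le_smallNorm μ hp h ht
  set I := (∫⁻ σ in Ioo 0 (t / 2), rearr μ h σ ^ p) ^ (1 / p)
  set l := 1 - Real.log t
  have hI : I ≤ ENNReal.ofReal (l ^ (-(1 - 1 / p))) * (4 * smallNorm μ p 1 h) := by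
    calc I = ENNReal.ofReal (l ^ (-(1 - 1 / p))) * (ENNReal.ofReal (l ^ (1 - 1 / p)) * I) := by
          rw [← mul_assoc, ← ENNReal.ofReal_mul (by positivity),
            ← Real.rpow_add (by positivity), neg_add_cancel, Real.rpow_zero, ENNReal.ofReal_one,
            one_mul]
      _ ≤ _ := by gcongr
  calc ENNReal.ofReal (s ^ (1 / p)) * rearr μ f s
      ≤ ENNReal.ofReal (s ^ (1 / p)) * (rearr μ g (s / 2) + rearr μ h (s / 2)) := by
        gcongr
        exact rearr_le_add hf hs.1.le
    _ = ENNReal.ofReal (s ^ (1 / p)) * rearr μ g (s / 2) +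
          ENNReal.ofReal (s ^ (1 / p)) * rearr μ h (s / 2) := mul_add _ _ _
    _ ≤ 2 * weakNorm μ p g +
          2 * ENNReal.ofReal ((s / 2) ^ (1 / p)) * rearr μ h (s / 2) := by
        refine add_le_add (ofReal_mul_rearr_half_le_weakNorm μ hp g hs') ?_
        gcongr
        exact ofReal_rpow_le_two_mul_half hp hs.1.le
    _ ≤ 8 * weakNorm μ p g +
          2 * (ENNReal.ofReal (l ^ (-(1 - 1 / p))) * (4 * smallNorm μ p 1 h)) := by
        rw [mul_assoc]
        refine add_le_add ?_ (mul_le_mul_right (hh.trans hI) 2)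
        gcongr
        norm_num
    _ = 8 * (weakNorm μ p g + ENNReal.ofReal (l ^ (-(1 - 1 / p))) * smallNorm μ p 1 h) := by
        ring

/-- On the block `(exp(1 - 2 (1 - log t)), t]`, on which `1 - log` at most doubles, the weighted
`L^p` norm of `f_*` is bounded by `K` at the single parameter `(1 - log t)⁻¹`. -/
lemma lintegral_block_le_peetreK (μ : Measure Ω) {p : ℝ} (hp : 1 < p) (f : Ω → ℝ) {t : ℝ}
    (ht : t ∈ Ioo (0 : ℝ) 1) :
    ∫⁻ σ in Ioc (Real.exp (1 - 2 * (1 - Real.log t))) t,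
        rearr μ f σ ^ p * ENNReal.ofReal (1 - Real.log σ)⁻¹ ≤
      (8 * peetreK μ (weakNorm μ p) (smallNorm μ p 1) f (1 - Real.log t)⁻¹) ^ p := by
  have hp0 : 0 < p := one_pos.trans hp
  rw [← ENNReal.rpow_inv_le_iff hp0]
  refine le_mul_peetreK (by norm_num) ENNReal.ofNat_ne_top fun g h _ _ hf => ?_
  rw [ENNReal.rpow_inv_le_iff hp0]
  have ht0 := ht.1
  have hl1 : 1 ≤ 1 - Real.log t := one_le_one_sub_log ht.1 ht.2.le
  have hsm := mul_rpow_le_smallNorm μ hp h ht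
  set N₀ := weakNorm μ p g
  set N₁ := smallNorm μ p 1 h
  set l := 1 - Real.log t with hl
  set I := ∫⁻ σ in Ioo 0 (t / 2), rearr μ h σ ^ p
  set u := Real.exp (1 - 2 * l)
  have hu0 : 0 < u := Real.exp_pos _
  have hut : u ≤ t := by
    rw [← Real.exp_log ht0]
    exact Real.exp_le_exp.2 (by linarith)
  -- The block has logarithmic length `log (t / u) = l`, which the weight `l⁻¹` compensates.
  have hg : ∫⁻ σ in Ioc u t, rearr μ g (σ / 2) ^ p ≤ (2 * N₀) ^ p * ENNReal.ofReal l := by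
    have hlog : Real.log (t / u) = l := by
      rw [Real.log_div ht0.ne' hu0.ne', Real.log_exp]; linarith
    rw [← hlog, ← lintegral_ofReal_inv hu0 hut, ← lintegral_const_mul _ (by fun_prop)]
    refine setLIntegral_mono' measurableSet_Ioc fun σ hσ => ?_
    have hσ0 : 0 < σ := hu0.trans hσ.1
    have h1 := ENNReal.rpow_le_rpow
      (ofReal_mul_rearr_half_le_weakNorm μ hp g ⟨hσ0, hσ.2.trans_lt ht.2⟩) hp0.le
    rw [ENNReal.mul_rpow_of_nonneg _ _ hp0.le, ENNReal.ofReal_rpow_of_pos (by positivity), one_div,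
      Real.rpow_inv_rpow hσ0.le hp0.ne'] at h1
    rw [ENNReal.ofReal_inv_of_pos hσ0, ← div_eq_mul_inv,
      ENNReal.le_div_iff_mul_le (Or.inl (by simpa using hσ0)) (Or.inl ENNReal.ofReal_ne_top),
      mul_comm]
    exact h1
  have hh : ∫⁻ σ in Ioc u t, rearr μ h (σ / 2) ^ p ≤ 2 * I := by
    rw [← lintegral_comp_half (fun σ => rearr μ h σ ^ p) t, setLIntegral_congr Ioo_ae_eq_Ioc.symm]
    exact lintegral_mono_set (Ioo_subset_Ioo_left hu0.le)
  have hI : ENNReal.ofReal l⁻¹ * I ≤ (ENNReal.ofReal l⁻¹ * (4 * N₁)) ^ p := by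
    refine le_trans (le_of_eq ?_) (ENNReal.rpow_le_rpow (mul_le_mul_right hsm _) hp0.le)
    rw [← mul_assoc, ← ENNReal.ofReal_mul (by positivity), ENNReal.mul_rpow_of_nonneg _ _ hp0.le,
      one_div p, ENNReal.rpow_inv_rpow hp0.ne', ENNReal.ofReal_rpow_of_pos (by positivity)]
    congr 2
    rw [← Real.rpow_neg_one, ← Real.rpow_add (by positivity), ← Real.rpow_mul (by positivity)]
    congr 1
    field_simp
    ring
  have hfin : ∫⁻ σ in Ioc u t, rearr μ f σ ^ p * ENNReal.ofReal (1 - Real.log σ)⁻¹ ≤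
      ENNReal.ofReal l⁻¹ * (2 ^ (p - 1) * ((2 * N₀) ^ p * ENNReal.ofReal l + 2 * I)) := by
    calc _ ≤ ∫⁻ σ in Ioc u t, ENNReal.ofReal l⁻¹ * (2 ^ (p - 1) *
          (rearr μ g (σ / 2) ^ p + rearr μ h (σ / 2) ^ p)) := by
          refine setLIntegral_mono' measurableSet_Ioc fun σ hσ => ?_
          have hσ0 : 0 < σ := hu0.trans hσ.1
          rw [mul_comm]
          have h2 : l ≤ 1 - Real.log σ := by linarith [Real.log_le_log hσ0 hσ.2]
          gcongr
          exact (ENNReal.rpow_le_rpow (rearr_le_add hf hσ0.le) hp0.le).trans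
            (ENNReal.rpow_add_le_mul_rpow_add_rpow _ _ hp.le)
      _ = ENNReal.ofReal l⁻¹ * (2 ^ (p - 1) * ((∫⁻ σ in Ioc u t, rearr μ g (σ / 2) ^ p) +
            ∫⁻ σ in Ioc u t, rearr μ h (σ / 2) ^ p)) := by
          have hm : ∀ k : Ω → ℝ, Measurable fun σ : ℝ => rearr μ k (σ / 2) ^ p := fun k =>
            ((measurable_rearr μ k).comp (measurable_id.div_const 2)).pow_const p
          rw [lintegral_const_mul' _ _ ENNReal.ofReal_ne_top,
            lintegral_const_mul' _ _ (ENNReal.rpow_ne_top_of_nonneg (by linarith)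
              ENNReal.ofNat_ne_top), lintegral_add_left (hm g)]
      _ ≤ _ := by gcongr
  refine hfin.trans ?_
  have h2p : (2 : ℝ≥0∞) ^ (p - 1) * 2 = 2 ^ p := by
    conv_lhs => rw [← ENNReal.rpow_one 2, ← ENNReal.rpow_mul, one_mul]
    rw [← ENNReal.rpow_add _ _ two_ne_zero ENNReal.ofNat_ne_top, sub_add_cancel]
  have hll : ENNReal.ofReal l⁻¹ * ENNReal.ofReal l = 1 := by
    rw [← ENNReal.ofReal_mul (by positivity), inv_mul_cancel₀ (by positivity), ENNReal.ofReal_one]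
  calc ENNReal.ofReal l⁻¹ * (2 ^ (p - 1) * ((2 * N₀) ^ p * ENNReal.ofReal l + 2 * I))
      = 2 ^ (p - 1) * ((2 * N₀) ^ p * (ENNReal.ofReal l⁻¹ * ENNReal.ofReal l) +
          2 * (ENNReal.ofReal l⁻¹ * I)) := by ring
    _ ≤ 2 ^ (p - 1) * (2 * (2 * N₀) ^ p + 2 * (ENNReal.ofReal l⁻¹ * (4 * N₁)) ^ p) := by
      rw [hll, mul_one]
      refine mul_le_mul_right (add_le_add ?_ (mul_le_mul_right hI 2)) _
      exact le_mul_of_one_le_left zero_le one_le_two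
    _ = 2 ^ (p - 1) * 2 * ((2 * N₀) ^ p + (ENNReal.ofReal l⁻¹ * (4 * N₁)) ^ p) := by ring
    _ ≤ 2 ^ p * (2 * N₀ + ENNReal.ofReal l⁻¹ * (4 * N₁)) ^ p := by
      rw [h2p]
      gcongr
      exact ENNReal.add_rpow_le_rpow_add _ _ hp.le
    _ = (4 * N₀ + 8 * (ENNReal.ofReal l⁻¹ * N₁)) ^ p := by
      rw [← ENNReal.mul_rpow_of_nonneg _ _ hp0.le]; congr 1; ring
    _ ≤ (8 * (N₀ + ENNReal.ofReal l⁻¹ * N₁)) ^ p := by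
      rw [mul_add]
      gcongr
      norm_num

/-! ### Passage to the interpolation norm -/

/-- The substitution `τ = lam (1 - log t)^{-κ}`, which maps `(0,1)` into `(0,lam)`. -/
lemma lintegral_comp_log_le {a κ lam : ℝ} (hκ : 0 < κ) (hlam : 0 < lam) (hlam1 : lam ≤ 1)
    (G : ℝ → ℝ≥0∞) :
    ∫⁻ t in Ioo (0 : ℝ) 1, ENNReal.ofReal (t⁻¹ * (1 - Real.log t) ^ (a * κ - 1)) *
        G (lam * (1 - Real.log t) ^ (-κ)) ≤
      ENNReal.ofReal (κ⁻¹ * lam ^ a) *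
        ∫⁻ τ in Ioo (0 : ℝ) 1, ENNReal.ofReal (τ ^ (-a - 1)) * G τ := by
  set φ : ℝ → ℝ := fun t => lam * (1 - Real.log t) ^ (-κ) with hφ
  set φ' : ℝ → ℝ := fun t => lam * ((-t⁻¹) * (-κ) * (1 - Real.log t) ^ (-κ - 1)) with hφ'
  have hl : ∀ t ∈ Ioo (0 : ℝ) 1, 1 < 1 - Real.log t := fun t ht => by
    linarith [Real.log_neg ht.1 ht.2]
  have hder : ∀ t ∈ Ioo (0 : ℝ) 1, HasDerivWithinAt φ (φ' t) (Ioo 0 1) t := fun t ht => by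
    have h1 : HasDerivAt (fun t => 1 - Real.log t) (-t⁻¹) t :=
      (Real.hasDerivAt_log ht.1.ne').const_sub 1
    exact ((h1.rpow_const (Or.inl (by linarith [hl t ht]))).const_mul lam).hasDerivWithinAt
  have hinj : InjOn φ (Ioo 0 1) := fun s hs t ht hst => by
    have h1 : (1 - Real.log s) ^ (-κ) = (1 - Real.log t) ^ (-κ) := mul_left_cancel₀ hlam.ne' hst
    have h2 := (Real.rpow_left_inj (by linarith [hl s hs]) (by linarith [hl t ht])
      (neg_ne_zero.2 hκ.ne')).1 h1
    exact Real.log_injOn_pos hs.1 ht.1 (by linarith)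
  have himg : φ '' Ioo 0 1 ⊆ Ioo 0 1 := by
    rintro _ ⟨t, ht, rfl⟩
    have h1 := hl t ht
    have h2 : (1 - Real.log t) ^ (-κ) < 1 := Real.rpow_lt_one_of_one_lt_of_neg h1 (by linarith)
    have h3 : 0 < (1 - Real.log t) ^ (-κ) := Real.rpow_pos_of_pos (by linarith) _
    exact ⟨mul_pos hlam h3, by simp only [hφ]; nlinarith⟩
  calc _ = ENNReal.ofReal (κ⁻¹ * lam ^ a) * ∫⁻ t in Ioo (0 : ℝ) 1, ENNReal.ofReal |φ' t| *
        (ENNReal.ofReal (φ t ^ (-a - 1)) * G (φ t)) := by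
        rw [← lintegral_const_mul' _ _ ENNReal.ofReal_ne_top]
        refine setLIntegral_congr_fun measurableSet_Ioo fun t ht => ?_
        have h1 : 0 < 1 - Real.log t := by linarith [hl t ht]
        have ht0 := ht.1
        rw [← mul_assoc, ← mul_assoc, ← ENNReal.ofReal_mul (by positivity),
          ← ENNReal.ofReal_mul (by positivity)]
        congr 2
        rw [abs_of_nonneg (by simp only [hφ']; rw [neg_mul_neg]; positivity)]
        simp only [hφ, hφ']
        rw [Real.mul_rpow hlam.le (by positivity), ← Real.rpow_mul h1.le]
        have e1 : lam ^ a * lam * lam ^ (-a - 1) = 1 := by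
          rw [← Real.rpow_add_one hlam.ne', ← Real.rpow_add hlam]; simp
        have e2 : (1 - Real.log t) ^ (a * κ - 1) =
            (1 - Real.log t) ^ (-κ - 1) * (1 - Real.log t) ^ (-κ * (-a - 1)) := by
          rw [← Real.rpow_add h1]; congr 1; ring
        rw [e2]
        calc _ = (lam ^ a * lam * lam ^ (-a - 1)) * (κ⁻¹ * κ) * (t⁻¹ *
              ((1 - Real.log t) ^ (-κ - 1) * (1 - Real.log t) ^ (-κ * (-a - 1)))) := by
              rw [e1, inv_mul_cancel₀ hκ.ne']; ring
          _ = _ := by ring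
    _ = ENNReal.ofReal (κ⁻¹ * lam ^ a) *
          ∫⁻ τ in φ '' Ioo 0 1, ENNReal.ofReal (τ ^ (-a - 1)) * G τ := by
        rw [lintegral_image_eq_lintegral_abs_deriv_mul measurableSet_Ioo hder hinj]
    _ ≤ _ := by
        gcongr

lemma interpNorm_rpow (μ : Measure Ω) (N₀ N₁ : (Ω → ℝ) → ℝ≥0∞) (θ : ℝ) {q : ℝ} (hq : 0 < q)
    (f : Ω → ℝ) :
    interpNorm μ N₀ N₁ θ q f ^ q =
      ∫⁻ t in Ioo (0 : ℝ) 1, ENNReal.ofReal (t ^ (-(q * θ) - 1)) * peetreK μ N₀ N₁ f t ^ q := by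
  rw [interpNorm, one_div, ENNReal.rpow_inv_rpow hq.ne']
  refine setLIntegral_congr_fun measurableSet_Ioo fun t ht => ?_
  have ht0 := ht.1
  rw [ENNReal.mul_rpow_of_nonneg _ _ hq.le, ENNReal.ofReal_rpow_of_pos (by positivity),
    ← Real.rpow_mul ht0.le]
  congr 4
  field_simp

/-- The supremum `sup t^{-θ} K(f,t)` is bounded by the part of the `q = 1` norm over `(t/2,t)`, where
`K` is at least `K(f,t)/2`. -/
lemma mul_peetreK_le_interpNorm_one (μ : Measure Ω) (N₀ N₁ : (Ω → ℝ) → ℝ≥0∞) {θ : ℝ}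
    (hθ : 0 < θ) (f : Ω → ℝ) {t : ℝ} (ht : t ∈ Ioo (0 : ℝ) 1) :
    ENNReal.ofReal (t ^ (-θ)) * peetreK μ N₀ N₁ f t ≤ 4 * interpNorm μ N₀ N₁ θ 1 f := by
  have ht0 := ht.1
  have h := interpNorm_rpow μ N₀ N₁ θ one_pos f
  simp only [ENNReal.rpow_one, one_mul] at h
  rw [h]
  have h1 : ENNReal.ofReal (t ^ (-θ - 1)) * peetreK μ N₀ N₁ f t * ENNReal.ofReal (t - t / 2) ≤
      2 * ∫⁻ s in Ioo (0 : ℝ) 1, ENNReal.ofReal (s ^ (-θ - 1)) * peetreK μ N₀ N₁ f s := by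
    rw [← Real.volume_Ioo, ← setLIntegral_const, ← lintegral_const_mul' _ _ ENNReal.ofNat_ne_top]
    refine (setLIntegral_mono' measurableSet_Ioo fun s hs => ?_).trans
      (lintegral_mono_set (Ioo_subset_Ioo (by positivity : (0 : ℝ) ≤ t / 2) ht.2.le))
    have hs0 : 0 < s := lt_trans (by positivity) hs.1
    rw [mul_left_comm]
    refine mul_le_mul' (ENNReal.ofReal_le_ofReal ?_)
      (peetreK_le_two_mul μ N₀ N₁ f (by linarith [hs.1]))
    exact Real.rpow_le_rpow_of_nonpos hs0 hs.2.le (by linarith)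
  calc ENNReal.ofReal (t ^ (-θ)) * peetreK μ N₀ N₁ f t
      = 2 * (ENNReal.ofReal (t ^ (-θ - 1)) * peetreK μ N₀ N₁ f t *
          ENNReal.ofReal (t - t / 2)) := by
        have e : t ^ (-θ) = 2 * (t ^ (-θ - 1) * (t - t / 2)) := by
          rw [Real.rpow_sub_one ht0.ne']; field_simp; ring
        rw [e, ENNReal.ofReal_mul two_pos.le, ENNReal.ofReal_mul (by positivity),
          ENNReal.ofReal_ofNat]
        ring
    _ ≤ 2 * (2 * ∫⁻ s in Ioo (0 : ℝ) 1, ENNReal.ofReal (s ^ (-θ - 1)) * peetreK μ N₀ N₁ f s) := by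
        gcongr
    _ = _ := by ring

/-- The embedding of `(X₀, X₁)_{θ,1}` into `(X₀, X₁)_{θ,r}`. -/
lemma interpNorm_le_interpNorm_one (μ : Measure Ω) (N₀ N₁ : (Ω → ℝ) → ℝ≥0∞) {θ r : ℝ}
    (hθ : 0 < θ) (hr : 1 ≤ r) (f : Ω → ℝ) :
    interpNorm μ N₀ N₁ θ r f ≤ 4 * interpNorm μ N₀ N₁ θ 1 f := by
  have hr0 : 0 < r := one_pos.trans_le hr
  rw [← ENNReal.rpow_le_rpow_iff hr0, interpNorm_rpow μ N₀ N₁ θ hr0 f]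
  set A := interpNorm μ N₀ N₁ θ 1 f with hA
  have h := interpNorm_rpow μ N₀ N₁ θ one_pos f
  simp only [ENNReal.rpow_one, one_mul] at h
  -- All but one of the `r` factors `t^{-θ} K(f,t)` are bounded by their supremum.
  have hsplit : ∀ x : ℝ≥0∞, x ^ (r - 1) * x = x ^ r := fun x => by
    conv_lhs => rw [← ENNReal.rpow_one x, ← ENNReal.rpow_mul, one_mul]
    rw [← ENNReal.rpow_add_of_nonneg _ _ (by linarith) zero_le_one, sub_add_cancel]
  calc ∫⁻ t in Ioo (0 : ℝ) 1, ENNReal.ofReal (t ^ (-(r * θ) - 1)) * peetreK μ N₀ N₁ f t ^ r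
      ≤ ∫⁻ t in Ioo (0 : ℝ) 1, (4 * A) ^ (r - 1) *
          (ENNReal.ofReal (t ^ (-θ - 1)) * peetreK μ N₀ N₁ f t) := by
        refine setLIntegral_mono' measurableSet_Ioo fun t ht => ?_
        have ht0 := ht.1
        set k := peetreK μ N₀ N₁ f t with hk
        calc ENNReal.ofReal (t ^ (-(r * θ) - 1)) * k ^ r
            = (ENNReal.ofReal (t ^ (-θ)) * k) ^ (r - 1) * (ENNReal.ofReal (t ^ (-θ - 1)) * k) := by
              rw [ENNReal.mul_rpow_of_nonneg _ _ (by linarith), ← hsplit k,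
                ENNReal.ofReal_rpow_of_pos (by positivity), ← Real.rpow_mul ht0.le]
              have e : t ^ (-(r * θ) - 1) = t ^ (-θ * (r - 1)) * t ^ (-θ - 1) := by
                rw [← Real.rpow_add ht0]; congr 1; ring
              rw [e, ENNReal.ofReal_mul (by positivity)]
              ring
          _ ≤ _ := by
              refine mul_le_mul_left (ENNReal.rpow_le_rpow ?_ (by linarith)) _
              exact mul_peetreK_le_interpNorm_one μ N₀ N₁ hθ f ht
    _ = (4 * A) ^ (r - 1) * A := by
        have hm : Measurable fun t : ℝ =>
            ENNReal.ofReal (t ^ (-θ - 1)) * peetreK μ N₀ N₁ f t :=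
          (by fun_prop : Measurable fun t : ℝ => ENNReal.ofReal (t ^ (-θ - 1))).mul
            (measurable_peetreK μ N₀ N₁ f)
        rw [lintegral_const_mul _ hm, ← h]
    _ ≤ (4 * A) ^ (r - 1) * (4 * A) := by
        gcongr
        exact le_mul_of_one_le_left zero_le (by norm_num)
    _ = (4 * A) ^ r := hsplit _

/-! ### The two embeddings -/

lemma gGammaSupNorm_le_interpNorm (μ : Measure Ω) {p θ r : ℝ} (hp : 1 < p) (hr : 1 ≤ r)
    (f : Ω → ℝ) :
    gGammaSupNorm μ r (fun t => t⁻¹ * (1 - Real.log t) ^ (r * θ * (1 - 1 / p) - 1))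
        (fun t => t ^ (1 / p)) f ≤
      8 * ENNReal.ofReal (1 - 1 / p)⁻¹ ^ (1 / r) *
        interpNorm μ (weakNorm μ p) (smallNorm μ p 1) θ r f := by
  have hr0 : 0 < r := one_pos.trans_le hr
  have hκ : 0 < 1 - 1 / p := by
    rw [sub_pos, div_lt_one (one_pos.trans hp)]; exact hp
  rw [gGammaSupNorm, one_div r, ENNReal.rpow_inv_le_iff hr0]
  set κ := 1 - 1 / p
  set K := peetreK μ (weakNorm μ p) (smallNorm μ p 1) f
  rw [ENNReal.mul_rpow_of_nonneg _ _ hr0.le, ENNReal.mul_rpow_of_nonneg _ _ hr0.le,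
    ENNReal.rpow_inv_rpow hr0.ne', interpNorm_rpow μ _ _ θ hr0 f]
  have hsub := lintegral_comp_log_le (a := r * θ) hκ one_pos le_rfl (fun τ => K τ ^ r)
  simp only [one_mul, Real.one_rpow, mul_one] at hsub
  calc _ ≤ ∫⁻ t in Ioo (0 : ℝ) 1, 8 ^ r * (ENNReal.ofReal (t⁻¹ * (1 - Real.log t) ^
          (r * θ * κ - 1)) * K ((1 - Real.log t) ^ (-κ)) ^ r) := by
        refine setLIntegral_mono' measurableSet_Ioo fun t ht => ?_
        rw [mul_left_comm, ← ENNReal.mul_rpow_of_nonneg _ _ hr0.le]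
        gcongr
        exact iSup_rearr_le_peetreK μ hp f ht
    _ = 8 ^ r * ∫⁻ t in Ioo (0 : ℝ) 1, ENNReal.ofReal (t⁻¹ * (1 - Real.log t) ^
          (r * θ * κ - 1)) * K ((1 - Real.log t) ^ (-κ)) ^ r :=
        lintegral_const_mul' _ _ (ENNReal.rpow_ne_top_of_nonneg hr0.le ENNReal.ofNat_ne_top)
    _ ≤ _ := by
        rw [mul_assoc (8 ^ r)]
        exact mul_le_mul_right hsub _

/-- The blocks on which `1 - log` runs from `2^j (1 - log t)` to `2^{j+1} (1 - log t)` cover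
`(0,t)`. -/
lemma Ioo_subset_iUnion_block {t : ℝ} (ht : t ∈ Ioo (0 : ℝ) 1) :
    Ioo 0 t ⊆ ⋃ j : ℕ, Ioc (Real.exp (1 - 2 * (2 ^ j * (1 - Real.log t))))
      (Real.exp (1 - 2 ^ j * (1 - Real.log t))) := by
  intro σ hσ
  have hl : 0 < 1 - Real.log t := by linarith [Real.log_neg ht.1 ht.2]
  have hlt := Real.log_lt_log hσ.1 hσ.2
  obtain ⟨j, h1, h2⟩ := exists_nat_pow_near (x := (1 - Real.log σ) / (1 - Real.log t))
    ((one_le_div hl).2 (by linarith)) one_lt_two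
  rw [le_div_iff₀ hl] at h1
  rw [div_lt_iff₀ hl, pow_succ] at h2
  refine mem_iUnion.2 ⟨j, ?_, ?_⟩
  · rw [← Real.lt_log_iff_exp_lt hσ.1]; linarith
  · rw [← Real.log_le_iff_le_exp hσ.1]; linarith

/-- A form of Hölder's inequality with geometric weights `ρ^j` that needs no relation between the
exponents. -/
lemma tsum_rpow_le_geometric {p r ρ : ℝ} (hp : 0 < p) (hr : 0 < r) (hρ : 0 < ρ)
    (a : ℕ → ℝ≥0∞) :
    (∑' j, a j ^ p) ^ (r / p) ≤ (∑' j, ENNReal.ofReal ((ρ ^ p) ^ j)) ^ (r / p) *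
      ∑' j, ENNReal.ofReal (((ρ⁻¹) ^ r) ^ j) * a j ^ r := by
  set S := ∑' j, ENNReal.ofReal (((ρ⁻¹) ^ r) ^ j) * a j ^ r with hS
  have hterm : ∀ j, a j ^ p ≤ ENNReal.ofReal ((ρ ^ p) ^ j) * S ^ (p / r) := fun j => by
    have h1 : ENNReal.ofReal (((ρ⁻¹) ^ r) ^ j) * a j ^ r ≤ S := ENNReal.le_tsum j
    have h2 := ENNReal.rpow_le_rpow h1 (by positivity : 0 ≤ p / r)
    refine le_trans (le_of_eq ?_) (mul_le_mul_right h2 _)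
    rw [ENNReal.mul_rpow_of_nonneg _ _ (by positivity), ← ENNReal.rpow_mul,
      mul_div_cancel₀ _ hr.ne', ENNReal.ofReal_rpow_of_pos (by positivity), ← mul_assoc,
      ← ENNReal.ofReal_mul (by positivity)]
    have e : (((ρ⁻¹) ^ r) ^ j) ^ (p / r) = ((ρ ^ p) ^ j)⁻¹ := by
      rw [← Real.rpow_natCast, ← Real.rpow_mul (by positivity), ← Real.rpow_mul (by positivity),
        ← Real.rpow_natCast, ← Real.rpow_mul hρ.le, Real.inv_rpow hρ.le]
      congr 2
      field_simp
    rw [e, mul_inv_cancel₀ (by positivity), ENNReal.ofReal_one, one_mul]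
  calc (∑' j, a j ^ p) ^ (r / p)
      ≤ (∑' j, ENNReal.ofReal ((ρ ^ p) ^ j) * S ^ (p / r)) ^ (r / p) :=
        ENNReal.rpow_le_rpow (ENNReal.tsum_le_tsum hterm) (by positivity)
    _ = _ := by
        rw [ENNReal.tsum_mul_right, ENNReal.mul_rpow_of_nonneg _ _ (by positivity),
          ← ENNReal.rpow_mul, div_mul_div_cancel₀ hr.ne', div_self hp.ne', ENNReal.rpow_one]

lemma tsum_ofReal_geometric_ne_top {x : ℝ} (h0 : 0 ≤ x) (h1 : x < 1) :
    ∑' j : ℕ, ENNReal.ofReal (x ^ j) ≠ ∞ :=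
  (summable_geometric_of_lt_one h0 h1).tsum_ofReal_ne_top

/-- The block at `2^j (1 - log t)` contributes `2^{-jrθ}` to the `r`-th power of the norm; the
weights `2^{±jθ/2}` leave both resulting series geometric. -/
lemma gGammaNorm_le_interpNorm (μ : Measure Ω) {p θ r : ℝ} (hp : 1 < p) (hr : 1 ≤ r)
    (f : Ω → ℝ) :
    gGammaNorm μ p r (fun t => t⁻¹ * (1 - Real.log t) ^ (r * θ - 1))
        (fun t => (1 - Real.log t)⁻¹) f ≤
      ((∑' j : ℕ, ENNReal.ofReal ((((2 : ℝ) ^ (-(θ / 2))) ^ p) ^ j)) ^ (r / p) *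
        (8 ^ r * ∑' j : ℕ, ENNReal.ofReal ((((2 : ℝ) ^ (-(θ / 2))) ^ r) ^ j))) ^ (1 / r) *
        interpNorm μ (weakNorm μ p) (smallNorm μ p 1) θ r f := by
  have hr0 : 0 < r := one_pos.trans_le hr
  have hp0 : 0 < p := one_pos.trans hp
  rw [gGammaNorm, one_div r, ENNReal.rpow_inv_le_iff hr0]
  set K := peetreK μ (weakNorm μ p) (smallNorm μ p 1) f with hK
  set ρ : ℝ := 2 ^ (-(θ / 2)) with hρ
  have hρ0 : 0 < ρ := by positivity
  rw [ENNReal.mul_rpow_of_nonneg _ _ hr0.le, ENNReal.rpow_inv_rpow hr0.ne',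
    interpNorm_rpow μ _ _ θ hr0 f]
  set M := (∑' j : ℕ, ENNReal.ofReal ((ρ ^ p) ^ j)) ^ (r / p)
  set E := ∫⁻ τ in Ioo (0 : ℝ) 1, ENNReal.ofReal (τ ^ (-(r * θ) - 1)) * K τ ^ r
  set w : ℝ → ℝ≥0∞ := fun t => ENNReal.ofReal (t⁻¹ * (1 - Real.log t) ^ (r * θ - 1)) with hw
  have hwm : Measurable w := by fun_prop
  have hpt : ∀ t ∈ Ioo (0 : ℝ) 1,
      (∫⁻ σ in Ioo 0 t, rearr μ f σ ^ p * ENNReal.ofReal (1 - Real.log σ)⁻¹) ^ (r / p) ≤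
        M * ∑' j : ℕ, ENNReal.ofReal (((ρ⁻¹) ^ r) ^ j) *
          (8 * K ((2 ^ j)⁻¹ * (1 - Real.log t)⁻¹)) ^ r := fun t ht => by
    refine le_trans (ENNReal.rpow_le_rpow ?_ (by positivity))
      (tsum_rpow_le_geometric hp0 hr0 hρ0 _)
    refine (lintegral_mono_set (Ioo_subset_iUnion_block ht)).trans
      ((lintegral_iUnion_le _ _).trans (ENNReal.tsum_le_tsum fun j => ?_))
    have hl : 1 < 1 - Real.log t := by linarith [Real.log_neg ht.1 ht.2]
    have h2j : (1 : ℝ) ≤ 2 ^ j := one_le_pow₀ one_le_two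
    have hb := lintegral_block_le_peetreK μ hp f
      (t := Real.exp (1 - 2 ^ j * (1 - Real.log t)))
      ⟨Real.exp_pos _, Real.exp_lt_one_iff.2 (by nlinarith)⟩
    simp only [Real.log_exp, sub_sub_cancel, mul_inv] at hb
    exact hb
  calc ∫⁻ t in Ioo (0 : ℝ) 1, w t *
        (∫⁻ σ in Ioo 0 t, rearr μ f σ ^ p * ENNReal.ofReal (1 - Real.log σ)⁻¹) ^ (r / p)
      ≤ ∫⁻ t in Ioo (0 : ℝ) 1, M * ∑' j : ℕ, ENNReal.ofReal (((ρ⁻¹) ^ r) ^ j) * 8 ^ r *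
          (w t * K ((2 ^ j)⁻¹ * (1 - Real.log t) ^ (-1 : ℝ)) ^ r) := by
        refine setLIntegral_mono' measurableSet_Ioo fun t ht => ?_
        refine (mul_le_mul_right (hpt t ht) _).trans (le_of_eq ?_)
        rw [mul_left_comm, ← ENNReal.tsum_mul_left]
        congr 1
        refine tsum_congr fun j => ?_
        rw [ENNReal.mul_rpow_of_nonneg _ _ hr0.le, Real.rpow_neg_one]
        ring
    _ = M * ∑' j : ℕ, ENNReal.ofReal (((ρ⁻¹) ^ r) ^ j) * 8 ^ r *
          ∫⁻ t in Ioo (0 : ℝ) 1, w t * K ((2 ^ j)⁻¹ * (1 - Real.log t) ^ (-1 : ℝ)) ^ r := by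
        have hm : ∀ j : ℕ, Measurable fun t =>
            w t * K ((2 ^ j)⁻¹ * (1 - Real.log t) ^ (-1 : ℝ)) ^ r := fun j =>
          hwm.mul (((measurable_peetreK μ _ _ f).comp (by fun_prop)).pow_const r)
        rw [lintegral_const_mul _ (Measurable.tsum fun j => (hm j).const_mul _),
          lintegral_tsum fun j => ((hm j).const_mul _).aemeasurable]
        congr 1
        exact tsum_congr fun j => lintegral_const_mul _ (hm j)
    _ ≤ M * ∑' j : ℕ, ENNReal.ofReal (((ρ⁻¹) ^ r) ^ j) * 8 ^ r *
          (ENNReal.ofReal (((2 : ℝ) ^ j)⁻¹ ^ (r * θ)) * E) := by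
        refine mul_le_mul_right (ENNReal.tsum_le_tsum fun j => mul_le_mul_right ?_ _) M
        have h := lintegral_comp_log_le (a := r * θ) one_pos (lam := ((2 : ℝ) ^ j)⁻¹)
          (by positivity) (inv_le_one_of_one_le₀ (one_le_pow₀ one_le_two)) (fun τ => K τ ^ r)
        simpa only [mul_one, inv_one, one_mul] using h
    _ = M * (8 ^ r * ∑' j : ℕ, ENNReal.ofReal ((ρ ^ r) ^ j)) * E := by
        rw [mul_assoc M, mul_assoc (8 ^ r), ← ENNReal.tsum_mul_right,
          ← ENNReal.tsum_mul_left (a := 8 ^ r)]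
        congr 1
        refine tsum_congr fun j => ?_
        have e : (ρ ^ r) ^ j = ((ρ⁻¹) ^ r) ^ j * ((2 : ℝ) ^ j)⁻¹ ^ (r * θ) := by
          rw [hρ, ← Real.rpow_natCast 2 j, ← Real.rpow_neg two_pos.le, ← Real.rpow_neg two_pos.le,
            ← Real.rpow_natCast, ← Real.rpow_natCast]
          simp only [← Real.rpow_mul two_pos.le]
          rw [← Real.rpow_add two_pos]
          congr 1
          ring
        rw [e, ENNReal.ofReal_mul (by positivity)]
        ring

end GGamma

theorem theorem1p6 (p θ r : ℝ) (hp : 1 < p) (hθ₀ : 0 < θ) (hθ₁ : θ < 1) (hr : 1 ≤ r) :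
    ∃ C : ℝ, 0 < C ∧
      ∀ (Ω : Type*) [MeasurableSpace Ω] (μ : Measure Ω) [IsProbabilityMeasure μ]
        (f : Ω → ℝ), Measurable f →
        ∀ q : ℝ, (q = 1 ∨ q = r) →
          max
            (GGamma.gGammaNorm μ p r
              (fun t => t⁻¹ * (1 - Real.log t) ^ (r * θ - 1))
              (fun t => (1 - Real.log t)⁻¹) f)
            (GGamma.gGammaSupNorm μ r
              (fun t => t⁻¹ * (1 - Real.log t) ^ (r * θ * (1 - 1 / p) - 1))
              (fun t => t ^ (1 / p)) f)
          ≤ ENNReal.ofReal C *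
            GGamma.interpNorm μ (GGamma.weakNorm μ p) (GGamma.smallNorm μ p 1) θ q f := by
  have hr0 : 0 < r := one_pos.trans_le hr
  have hp0 : 0 < p := one_pos.trans hp
  obtain ⟨A, hA, hA'⟩ : ∃ A : ℝ≥0∞, A = ((∑' j : ℕ, ENNReal.ofReal
      ((((2 : ℝ) ^ (-(θ / 2))) ^ p) ^ j)) ^ (r / p) * (8 ^ r * ∑' j : ℕ,
        ENNReal.ofReal ((((2 : ℝ) ^ (-(θ / 2))) ^ r) ^ j))) ^ (1 / r) ∧ A ≠ ∞ := by
    have hρ : (2 : ℝ) ^ (-(θ / 2)) < 1 :=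
      Real.rpow_lt_one_of_one_lt_of_neg one_lt_two (by linarith)
    have hgeo : ∀ s : ℝ, 0 < s →
        ∑' j : ℕ, ENNReal.ofReal ((((2 : ℝ) ^ (-(θ / 2))) ^ s) ^ j) ≠ ∞ := fun s hs =>
      GGamma.tsum_ofReal_geometric_ne_top (by positivity)
        (Real.rpow_lt_one (by positivity) hρ hs)
    refine ⟨_, rfl, ENNReal.rpow_ne_top_of_nonneg (by positivity) (ENNReal.mul_ne_top ?_
      (ENNReal.mul_ne_top ?_ (hgeo r hr0)))⟩
    · exact ENNReal.rpow_ne_top_of_nonneg (by positivity) (hgeo p hp0)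
    · exact ENNReal.rpow_ne_top_of_nonneg hr0.le ENNReal.ofNat_ne_top
  obtain ⟨B, hB, hB'⟩ : ∃ B : ℝ≥0∞,
      B = 8 * ENNReal.ofReal (1 - 1 / p)⁻¹ ^ (1 / r) ∧ B ≠ ∞ :=
    ⟨_, rfl, ENNReal.mul_ne_top ENNReal.ofNat_ne_top
      (ENNReal.rpow_ne_top_of_nonneg (by positivity) ENNReal.ofReal_ne_top)⟩
  have hAB : 4 * max A B ≠ ∞ := ENNReal.mul_ne_top ENNReal.ofNat_ne_top
    (max_lt hA'.lt_top hB'.lt_top).ne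
  refine ⟨(4 * max A B).toReal + 1, by positivity, fun Ω _ μ _ f _ q hq => ?_⟩
  have hC : 4 * max A B ≤ ENNReal.ofReal ((4 * max A B).toReal + 1) :=
    ENNReal.le_ofReal_iff_toReal_le hAB (by positivity) |>.2 (by linarith)
  have hmain : max (GGamma.gGammaNorm μ p r (fun t => t⁻¹ * (1 - Real.log t) ^ (r * θ - 1))
        (fun t => (1 - Real.log t)⁻¹) f)
      (GGamma.gGammaSupNorm μ r
        (fun t => t⁻¹ * (1 - Real.log t) ^ (r * θ * (1 - 1 / p) - 1)) (fun t => t ^ (1 / p)) f)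
      ≤ max A B * GGamma.interpNorm μ (GGamma.weakNorm μ p) (GGamma.smallNorm μ p 1) θ r f :=
    max_le
      ((GGamma.gGammaNorm_le_interpNorm μ hp hr f).trans
        (hA ▸ mul_le_mul_left (le_max_left A B) _))
      ((GGamma.gGammaSupNorm_le_interpNorm μ hp hr f).trans
        (hB ▸ mul_le_mul_left (le_max_right A B) _))
  have hq' : GGamma.interpNorm μ (GGamma.weakNorm μ p) (GGamma.smallNorm μ p 1) θ r f ≤
      4 * GGamma.interpNorm μ (GGamma.weakNorm μ p) (GGamma.smallNorm μ p 1) θ q f := by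
    rcases hq with rfl | rfl
    · exact GGamma.interpNorm_le_interpNorm_one μ _ _ hθ₀ hr f
    · exact le_mul_of_one_le_left zero_le (by norm_num)
  calc _ ≤ _ := hmain
    _ ≤ max A B * (4 * GGamma.interpNorm μ (GGamma.weakNorm μ p) (GGamma.smallNorm μ p 1) θ q f) :=
        mul_le_mul_right hq' _
    _ = 4 * max A B * GGamma.interpNorm μ (GGamma.weakNorm μ p) (GGamma.smallNorm μ p 1) θ q f := by
        ring
    _ ≤ _ := mul_le_mul_left hC _
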